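/- Let $SO(n)$ be the group of real special orthogonal $n\times n$ matrices, with the topology of a subspace of the matrices, and let $i_2\colon SO(2)\to SO(3)$ be the inclusion $A\mapsto\begin{pmatrix}A&0\\0&1\end{pmatrix}$. (1) There is an isomorphism $\pi_1(SO(2),I)\cong\mathbb Z$ under which the class of the loop $t\mapsto\begin{pmatrix}\cos 2\pi t&-\sin 2\pi t\\ \sin 2\pi t&\cos 2\pi t\end{pmatrix}$, $t\in[0,1]$, corresponds to $1$, and $\pi_1(SO(3),I)=\langle i_{2*}(1)\rangle$; that is, the class of the loop of rotations about the $z$-axis by the angles $2\pi t$, $0\le t\le 1$, generates $\pi_1(SO(3),I)$. (2) Let $X$ be the quotient space of the closed ball of radius $\pi$ about the origin of $\mathbb R^3$ in which antipodal points of the boundary are identified. Let $\phi\colon X\to SO(3)$ be the map that sends $[v]$ to the rotation with axis directed by $v$ and angle $\|v\|$ (the identity if $v=0$), and let $\gamma\colon[0,1]\to X$ be the loop $\gamma(t)=[0,0,\pi\cos\pi t]$, so that $\phi\circ\gamma$ is a loop of rotations about the $z$-axis. Then $\phi_*([\gamma])$ generates $\pi_1(SO(3),\phi(\gamma(0)))$.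 -/

import Mathlib

open scoped Matrix unitInterval

noncomputable section

/-- The special orthogonal group `SO(n)`, a topological space as a subspace of the space of real
`n × n` matrices. -/
abbrev SO (n : ℕ) : Type := Matrix.specialOrthogonalGroup (Fin n) ℝ

theorem SO.mem_iff {n : ℕ} {A : Matrix (Fin n) (Fin n) ℝ} :
    A ∈ Matrix.specialOrthogonalGroup (Fin n) ℝ ↔ A * Aᵀ = 1 ∧ A.det = 1 := by
  rw [Matrix.mem_specialOrthogonalGroup_iff, Matrix.mem_orthogonalGroup_iff]

/-! ### The inclusion of `SO(2)` in `SO(3)` and the standard loop of `SO(2)` -/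

/-- The block matrix `diag(A, 1)`. -/
def blockMatrix (A : Matrix (Fin 2) (Fin 2) ℝ) : Matrix (Fin 3) (Fin 3) ℝ :=
  !![A 0 0, A 0 1, 0; A 1 0, A 1 1, 0; 0, 0, 1]

theorem blockMatrix_mem {A : Matrix (Fin 2) (Fin 2) ℝ}
    (hA : A ∈ Matrix.specialOrthogonalGroup (Fin 2) ℝ) :
    blockMatrix A ∈ Matrix.specialOrthogonalGroup (Fin 3) ℝ := by
  rw [Matrix.mem_specialOrthogonalGroup_fin_two_iff] at hA
  obtain ⟨h1, h2, h3⟩ := hA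
  rw [SO.mem_iff]
  constructor
  · ext i j
    fin_cases i <;> fin_cases j <;>
      simp [blockMatrix, Matrix.mul_apply, Fin.sum_univ_three] <;> grind
  · simp [blockMatrix, Matrix.det_fin_three]
    grind

theorem continuous_blockMatrix : Continuous blockMatrix := by
  refine continuous_matrix fun i j => ?_
  fin_cases i <;> fin_cases j <;> simp [blockMatrix] <;> fun_prop

/-- The natural inclusion `i₂ : SO(2) → SO(3)`, `A ↦ diag(A, 1)`. -/
def inclSO : C(SO 2, SO 3) where
  toFun A := ⟨blockMatrix A.1, blockMatrix_mem A.2⟩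
  continuous_toFun := (continuous_blockMatrix.comp continuous_subtype_val).subtype_mk _

theorem inclSO_one : inclSO 1 = 1 := by
  apply Subtype.ext
  ext i j
  fin_cases i <;> fin_cases j <;> simp [inclSO, blockMatrix]

/-- The rotation of the plane by the angle `θ`. -/
def planeRotation (θ : ℝ) : SO 2 :=
  ⟨!![Real.cos θ, -Real.sin θ; Real.sin θ, Real.cos θ], by
    rw [Matrix.of_mem_specialOrthogonalGroup_fin_two_iff]
    exact ⟨rfl, rfl, by rw [neg_sq]; exact Real.cos_sq_add_sin_sq θ⟩⟩

/-- The standard loop `t ↦ (rotation by the angle 2πt)` of `SO(2)`, which runs once around it. -/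
def planeRotationLoop : Path (1 : SO 2) 1 where
  toFun t := planeRotation (2 * Real.pi * t)
  continuous_toFun := by
    refine Continuous.subtype_mk (continuous_matrix fun i j => ?_) _
    fin_cases i <;> fin_cases j <;> simp <;> fun_prop
  source' := by
    apply Subtype.ext
    ext i j
    fin_cases i <;> fin_cases j <;> simp [planeRotation]
  target' := by
    apply Subtype.ext
    ext i j
    fin_cases i <;> fin_cases j <;> simp [planeRotation]

/-- The class of the standard loop in `π₁(SO(2), 1)`. -/
def planeRotationClass : FundamentalGroup (SO 2) 1 :=
  FundamentalGroup.fromPath (Path.Homotopic.Quotient.mk planeRotationLoop)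

/-! ### The ball model of `SO(3)` -/

/-- The matrix of the linear map `x ↦ u × x` of `ℝ³`. -/
def crossMatrix (u : EuclideanSpace ℝ (Fin 3)) : Matrix (Fin 3) (Fin 3) ℝ :=
  !![0, -u 2, u 1; u 2, 0, -u 0; -u 1, u 0, 0]

/-- For a unit vector `u`, the matrix of the rotation of `ℝ³` about the axis directed by `u`
by the angle `θ`: it sends `x` to `cos θ • x + sin θ • (u × x) + (1 - cos θ) • ⟪u, x⟫ • u`. -/
def axisRotation (u : EuclideanSpace ℝ (Fin 3)) (θ : ℝ) : Matrix (Fin 3) (Fin 3) ℝ :=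
  Real.cos θ • (1 : Matrix (Fin 3) (Fin 3) ℝ) + Real.sin θ • crossMatrix u
    + (1 - Real.cos θ) • Matrix.vecMulVec u u

/-- The rotation about the axis directed by `v` by the angle `‖v‖`; for `v = 0` it is the
identity matrix. -/
def vectorRotation (v : EuclideanSpace ℝ (Fin 3)) : Matrix (Fin 3) (Fin 3) ℝ :=
  axisRotation (‖v‖⁻¹ • v) ‖v‖

theorem vectorRotation_zero : vectorRotation 0 = 1 := by
  ext i j
  simp [vectorRotation, axisRotation]

theorem axisRotation_mem {u : EuclideanSpace ℝ (Fin 3)} (hu : ‖u‖ = 1) (θ : ℝ) :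
    axisRotation u θ ∈ Matrix.specialOrthogonalGroup (Fin 3) ℝ := by
  have key : ∀ a b c s k : ℝ, a ^ 2 + b ^ 2 + c ^ 2 = 1 → s ^ 2 + k ^ 2 = 1 →
      !![k + (1 - k) * (a * a), -(s * c) + (1 - k) * (a * b), s * b + (1 - k) * (a * c);
        s * c + (1 - k) * (b * a), k + (1 - k) * (b * b), -(s * a) + (1 - k) * (b * c);
        -(s * b) + (1 - k) * (c * a), s * a + (1 - k) * (c * b), k + (1 - k) * (c * c)] ∈
      Matrix.specialOrthogonalGroup (Fin 3) ℝ := by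
    intro a b c s k h hs
    rw [SO.mem_iff]
    constructor
    · ext i j
      fin_cases i <;> fin_cases j <;>
        simp [Matrix.mul_apply, Fin.sum_univ_three] <;> grind
    · simp [Matrix.det_fin_three]
      grind
  have h : u 0 ^ 2 + u 1 ^ 2 + u 2 ^ 2 = 1 := by
    have := EuclideanSpace.real_norm_sq_eq u
    rw [hu, Fin.sum_univ_three] at this
    linarith
  convert key (u 0) (u 1) (u 2) (Real.sin θ) (Real.cos θ) h (Real.sin_sq_add_cos_sq θ) using 1
  ext i j
  fin_cases i <;> fin_cases j <;> simp [axisRotation, crossMatrix, Matrix.vecMulVec_apply]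

theorem vectorRotation_mem (v : EuclideanSpace ℝ (Fin 3)) :
    vectorRotation v ∈ Matrix.specialOrthogonalGroup (Fin 3) ℝ := by
  by_cases hv : v = 0
  · rw [hv, vectorRotation_zero]
    exact one_mem _
  · exact axisRotation_mem (norm_smul_inv_norm (𝕜 := ℝ) hv) _

theorem vectorRotation_eq (v : EuclideanSpace ℝ (Fin 3)) :
    vectorRotation v = Real.cos ‖v‖ • (1 : Matrix (Fin 3) (Fin 3) ℝ)
      + Real.sinc ‖v‖ • crossMatrix v
      + (Real.sinc (‖v‖ / 2) ^ 2 / 2) • Matrix.vecMulVec v v := by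
  by_cases hv : v = 0
  · subst hv
    rw [vectorRotation_zero]
    ext i j
    fin_cases i <;> fin_cases j <;> simp [crossMatrix]
  · have h0 : ‖v‖ ≠ 0 := norm_ne_zero_iff.mpr hv
    have hc : 1 - Real.cos ‖v‖ = 2 * Real.sin (‖v‖ / 2) ^ 2 := by
      have := Real.cos_sq_add_sin_sq (‖v‖ / 2)
      have h2 := Real.cos_two_mul (‖v‖ / 2)
      rw [mul_div_cancel₀ _ (two_ne_zero)] at h2
      linarith
    rw [vectorRotation, axisRotation, hc, Real.sinc_of_ne_zero h0,
      Real.sinc_of_ne_zero (div_ne_zero h0 two_ne_zero)]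
    ext i j
    fin_cases i <;> fin_cases j <;> simp [crossMatrix, Matrix.vecMulVec_apply] <;>
      field_simp

theorem continuous_vectorRotation : Continuous vectorRotation := by
  have h : vectorRotation = _ := funext vectorRotation_eq
  rw [h]
  have hs := Real.continuous_sinc
  refine continuous_matrix fun i j => ?_
  fin_cases i <;> fin_cases j <;>
    simp [crossMatrix, Matrix.vecMulVec_apply] <;> fun_prop

theorem vectorRotation_neg {v : EuclideanSpace ℝ (Fin 3)} (hv : ‖v‖ = Real.pi) :
    vectorRotation (-v) = vectorRotation v := by
  ext i j
  simp [vectorRotation, axisRotation, hv, Matrix.vecMulVec_apply]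

/-- The closed ball of `ℝ³` with centre the origin and radius `π`. -/
abbrev PiBall : Type := Metric.closedBall (0 : EuclideanSpace ℝ (Fin 3)) Real.pi

/-- The equivalence relation on the closed ball that identifies antipodal boundary points. -/
def antipodalSetoid : Setoid PiBall where
  r p q := p = q ∨ (‖p.1‖ = Real.pi ∧ q.1 = -p.1)
  iseqv :=
    { refl := fun _ => Or.inl rfl
      symm := by
        rintro p q (rfl | ⟨h1, h2⟩)
        · exact Or.inl rfl
        · exact Or.inr ⟨by rw [h2, norm_neg, h1], by rw [h2, neg_neg]⟩
      trans := by
        rintro p q r (rfl | ⟨h1, h2⟩) (rfl | ⟨h3, h4⟩)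
        · exact Or.inl rfl
        · exact Or.inr ⟨h3, h4⟩
        · exact Or.inr ⟨h1, h2⟩
        · exact Or.inl (Subtype.ext (by rw [h4, h2, neg_neg])) }

/-- The space `X`: the closed ball of radius `π` with antipodal boundary points identified, with
the quotient topology. -/
abbrev BallModel : Type := Quotient antipodalSetoid

/-- The map `φ : X → SO(3)` that sends `[v]` to the rotation with axis directed by `v` and
angle `‖v‖`. -/
def ballModelToSO : C(BallModel, SO 3) where
  toFun := Quotient.lift (fun p : PiBall => (⟨vectorRotation p.1, vectorRotation_mem p.1⟩ : SO 3))
    (by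
      rintro p q (rfl | ⟨h1, h2⟩)
      · rfl
      · refine Subtype.ext ?_
        change vectorRotation p.1 = vectorRotation q.1
        rw [h2, vectorRotation_neg h1])
  continuous_toFun := Continuous.quotient_lift
    ((continuous_vectorRotation.comp continuous_subtype_val).subtype_mk _) _

/-- The point `(0, 0, π cos s)` of the ball. -/
def zAxisPoint (s : ℝ) : PiBall :=
  ⟨!₂[0, 0, Real.pi * Real.cos s], by
    rw [mem_closedBall_zero_iff, EuclideanSpace.norm_eq, Fin.sum_univ_three]
    simp only [Matrix.cons_val, norm_zero, Real.norm_eq_abs, sq_abs]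
    rw [zero_pow two_ne_zero, zero_add, zero_add, Real.sqrt_sq_eq_abs, abs_mul,
      abs_of_pos Real.pi_pos]
    exact mul_le_of_le_one_right Real.pi_pos.le (Real.abs_cos_le_one s)⟩

theorem continuous_zAxisPoint : Continuous zAxisPoint := by
  refine Continuous.subtype_mk ?_ _
  refine (PiLp.continuous_toLp 2 _).comp (continuous_pi fun i => ?_)
  fin_cases i <;> simp <;> fun_prop

/-- The class `[0, 0, π]` in `X`. -/
def ballModelPole : BallModel := Quotient.mk antipodalSetoid (zAxisPoint 0)

/-- The loop `γ(t) = [0, 0, π cos πt]` of `X`, based at `[0, 0, π]`. -/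
def zAxisLoop : Path ballModelPole ballModelPole where
  toFun t := Quotient.mk antipodalSetoid (zAxisPoint (Real.pi * t))
  continuous_toFun := continuous_quotient_mk'.comp (continuous_zAxisPoint.comp (by fun_prop))
  source' := by simp [ballModelPole]
  target' := by
    refine Quotient.sound (Or.inr ⟨?_, ?_⟩)
    · simp [zAxisPoint, EuclideanSpace.norm_eq, Fin.sum_univ_three, Real.pi_pos.le]
    · ext i
      fin_cases i <;> simp [zAxisPoint]

/-- The class `[γ]` in `π₁(X, [0, 0, π])`. -/
def zAxisClass : FundamentalGroup BallModel ballModelPole :=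
  FundamentalGroup.fromPath (Path.Homotopic.Quotient.mk zAxisLoop)

end

/-!
For `SO(2)`: the map `t ↦ (rotation by 2πt)` is the covering of `SO(2)` by the simply connected
group `ℝ` with deck group `ℤ`, and the lift from `0` of the standard loop ends at `1`. Hence
`π₁(SO(2))` is infinite cyclic with the class of the standard loop as a generator
(`bijective_zpowers_planeRotationClass`).

For `SO(3)`: conjugation of imaginary quaternions by unit quaternions is a surjective homomorphism
`S³ → SO(3)` with kernel `{1, -1}`, hence a twofold covering
(`isQuotientCoveringMap_quaternionToSO`). The sphere `S³` is simply connected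
(`simplyConnectedSpace_sphere`), so `π₁(SO(3))` has at most one nontrivial element, and a loop whose
lift joins a unit quaternion to its antipode is a generator at whatever base point
(`zpowers_eq_top_of_lift`). Both loops in question consist of rotations about the `z`-axis, by the
angles `2πt` and `π cos πt` respectively; the rotation by `2θ` lifts to `cos θ + sin θ k`, so the
lifts run from `1` to `-1` and from `k` to `-k`.
-/

open Metric Module
open scoped Quaternion

/-! ### Simple connectedness of spheres -/

/-- Stereographic projection identifies a punctured sphere with a vector space. -/
theorem isSimplyConnected_compl_singleton_sphere {E : Type*} [NormedAddCommGroup E]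
    [InnerProductSpace ℝ E] (v : sphere (0 : E) 1) :
    IsSimplyConnected ({v}ᶜ : Set (sphere (0 : E) 1)) := by
  have h : SimplyConnectedSpace (Set.univ : Set (ℝ ∙ (v : E))ᗮ) :=
    (Homeomorph.Set.univ _).toHomotopyEquiv.simplyConnectedSpace
  exact ((stereographic (norm_eq_of_mem_sphere v)).toHomeomorphSourceTarget).toHomotopyEquiv
    |>.simplyConnectedSpace (hY := h)

/-- A path in a normed space is uniformly close to a `C¹` curve, defined on all of `ℝ`, with the
same endpoints: the Bernstein polynomials of the path do this. -/
theorem exists_contDiff_approx {E : Type*} [NormedAddCommGroup E] [NormedSpace ℝ E]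
    (f : C(I, E)) {ε : ℝ} (hε : 0 < ε) :
    ∃ D : ℝ → E, ContDiff ℝ 1 D ∧ D 0 = f 0 ∧ D 1 = f 1 ∧ ∀ t : I, ‖D t - f t‖ < ε := by
  have h1 : ∀ᶠ n in Filter.atTop, ‖bernsteinApproximation n f - f‖ < ε := by
    have := (tendsto_iff_norm_sub_tendsto_zero.mp (bernsteinApproximation_uniform f))
    exact this.eventually_lt_const hε
  obtain ⟨n, hn, hn0⟩ := (h1.and (Filter.eventually_ne_atTop 0)).exists
  let D : ℝ → E := fun t ↦ ∑ k : Fin (n + 1),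
    ((n.choose k : ℝ) * t ^ (k : ℕ) * (1 - t) ^ (n - k)) • f (bernstein.z k)
  have hD : ∀ t : I, D t = bernsteinApproximation n f t := fun t ↦ by
    simp only [D, bernsteinApproximation.apply, bernstein_apply]
  refine ⟨D, ?_, ?_, ?_, fun t ↦ ?_⟩
  · refine ContDiff.sum fun k _ ↦ ContDiff.smul ?_ contDiff_const
    fun_prop
  · simpa using hD 0
  · simpa [hn0] using hD 1
  · rw [hD]
    exact ((bernsteinApproximation n f - f).norm_coe_le_norm t).trans_lt hn

/-- A sphere of dimension at least two is simply connected: a loop in it is homotopic to one that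
misses a point, and a punctured sphere is contractible. To find the missed point, the loop is
replaced by the radial projection of a `C¹` curve: the cone over that curve is a `C¹` image of the
plane, which does not fill a space of dimension at least three. -/
theorem simplyConnectedSpace_sphere {E : Type*} [NormedAddCommGroup E] [InnerProductSpace ℝ E]
    [FiniteDimensional ℝ E] (hE : 2 < finrank ℝ E) :
    SimplyConnectedSpace (sphere (0 : E) 1) := by
  rw [simply_connected_iff_loops_nullhomotopic]
  have hrank : 1 < Module.rank ℝ E := by
    rw [← finrank_eq_rank]; exact_mod_cast (by omega : 1 < finrank ℝ E)
  refine ⟨isPathConnected_iff_pathConnectedSpace.mp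
    (isPathConnected_sphere hrank 0 zero_le_one), fun x γ ↦ ?_⟩
  obtain ⟨D, hD, hD0, hD1, hDγ⟩ := exists_contDiff_approx
    (⟨fun t ↦ (γ t : E), by fun_prop⟩ : C(I, E)) zero_lt_one
  simp only [ContinuousMap.coe_mk, γ.source, γ.target] at hD0 hD1 hDγ
  -- The cone over the curve `D` is the image of a plane, so it misses some vector `v`.
  obtain ⟨v, hv⟩ : ∃ v : E, ∀ s t : ℝ, s • D t ≠ v := by
    have hcone : ContDiff ℝ 1 fun q : ℝ × ℝ ↦ q.1 • D q.2 :=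
      contDiff_fst.smul (hD.comp contDiff_snd)
    obtain ⟨v, hv⟩ := (hcone.dense_compl_range_of_finrank_lt_finrank (by simpa)).nonempty
    exact ⟨v, fun s t h ↦ hv ⟨(s, t), h⟩⟩
  have hv0 : v ≠ 0 := fun h ↦ hv 0 0 (by rw [h, zero_smul])
  let u : sphere (0 : E) 1 := ⟨‖v‖⁻¹ • v, by simp [norm_smul, hv0]⟩
  have hγ (t : I) : ‖(γ t : E)‖ = 1 := norm_eq_of_mem_sphere _
  have hne (s t : I) : (γ t : E) + (s : ℝ) • (D t - γ t) ≠ 0 := by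
    intro h
    have h2 : ‖(γ t : E)‖ = ‖(s : ℝ) • (D t - γ t)‖ := by
      conv_lhs => rw [eq_neg_of_add_eq_zero_left h, norm_neg]
    rw [hγ, norm_smul, Real.norm_of_nonneg s.2.1] at h2
    nlinarith [hDγ t, s.2.2, norm_nonneg (D t - γ t), s.2.1]
  have hDne (t : I) : D t ≠ 0 := by simpa using hne 1 t
  have hcD : Continuous D := hD.continuous
  -- The radial projection of `D`; the segments from `γ t` to `D t` avoid the origin, and their
  -- radial projection is a homotopy from `γ` to `δ`.
  let δ : Path x x :=
    { toFun t := ⟨‖D t‖⁻¹ • D t, by simp [norm_smul, hDne]⟩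
      continuous_toFun := by
        have : Continuous fun t : I ↦ ‖D t‖⁻¹ :=
          Continuous.inv₀ (by fun_prop) fun t ↦ norm_ne_zero_iff.mpr (hDne t)
        fun_prop
      source' := Subtype.ext (by simp [hD0])
      target' := Subtype.ext (by simp [hD1]) }
  have h1 : γ.Homotopic δ := by
    refine ⟨⟨⟨⟨fun q ↦ ⟨‖(γ q.2 : E) + (q.1 : ℝ) • (D q.2 - γ q.2)‖⁻¹ •
      ((γ q.2 : E) + (q.1 : ℝ) • (D q.2 - γ q.2)), ?_⟩, ?_⟩, ?_, ?_⟩, ?_⟩⟩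
    · rw [mem_sphere_zero_iff_norm, norm_smul, norm_inv, norm_norm,
        inv_mul_cancel₀ (norm_ne_zero_iff.mpr (hne _ _))]
    · have : Continuous fun q : I × I ↦ ‖(γ q.2 : E) + (q.1 : ℝ) • (D q.2 - γ q.2)‖⁻¹ :=
        Continuous.inv₀ (by fun_prop) fun q ↦ norm_ne_zero_iff.mpr (hne _ _)
      fun_prop
    · intro t
      exact Subtype.ext (by simp)
    · intro t
      exact Subtype.ext (by simp [δ])
    · rintro s t (rfl | rfl) <;> exact Subtype.ext (by simp [hD0, hD1])
  have hδ (t : I) : δ t ∈ ({u}ᶜ : Set (sphere (0 : E) 1)) := by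
    intro h
    have h' : ‖D t‖⁻¹ • D t = ‖v‖⁻¹ • v := congrArg Subtype.val h
    refine hv (‖v‖ * ‖D t‖⁻¹) t ?_
    rw [mul_smul, h', smul_inv_smul₀ (norm_ne_zero_iff.mpr hv0)]
  obtain ⟨F, -⟩ := (isSimplyConnected_iff_exists_homotopy_refl_forall_mem.mp
    (isSimplyConnected_compl_singleton_sphere u)).2 x δ hδ
  exact h1.trans ⟨F⟩

/-! ### The double covering of `SO(3)` by the unit quaternions -/

/-- The matrix of the linear map `x ↦ q x q̄` of the purely imaginary quaternions, in the basis
`i, j, k`. -/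
def quaternionMatrix (q : ℍ[ℝ]) : Matrix (Fin 3) (Fin 3) ℝ :=
  !![q.re ^ 2 + q.imI ^ 2 - q.imJ ^ 2 - q.imK ^ 2, 2 * (q.imI * q.imJ - q.re * q.imK),
      2 * (q.imI * q.imK + q.re * q.imJ);
    2 * (q.imI * q.imJ + q.re * q.imK), q.re ^ 2 - q.imI ^ 2 + q.imJ ^ 2 - q.imK ^ 2,
      2 * (q.imJ * q.imK - q.re * q.imI);
    2 * (q.imI * q.imK - q.re * q.imJ), 2 * (q.imJ * q.imK + q.re * q.imI),
      q.re ^ 2 - q.imI ^ 2 - q.imJ ^ 2 + q.imK ^ 2]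

theorem quaternionMatrix_one : quaternionMatrix 1 = 1 := by
  ext i j
  fin_cases i <;> fin_cases j <;> simp [quaternionMatrix]

theorem quaternionMatrix_mul (p q : ℍ[ℝ]) :
    quaternionMatrix (p * q) = quaternionMatrix p * quaternionMatrix q := by
  ext i j
  fin_cases i <;> fin_cases j <;>
    simp [quaternionMatrix, Matrix.mul_apply, Fin.sum_univ_three] <;> ring

theorem mem_sphere_quaternion_iff {q : ℍ[ℝ]} :
    q ∈ sphere (0 : ℍ[ℝ]) 1 ↔ q.re ^ 2 + q.imI ^ 2 + q.imJ ^ 2 + q.imK ^ 2 = 1 := by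
  rw [← Quaternion.normSq_def', Quaternion.normSq_eq_norm_mul_self, mem_sphere_zero_iff_norm,
    ← sq, pow_eq_one_iff_of_nonneg (norm_nonneg q) two_ne_zero]

theorem quaternionMatrix_mem (q : sphere (0 : ℍ[ℝ]) 1) :
    quaternionMatrix q ∈ Matrix.specialOrthogonalGroup (Fin 3) ℝ := by
  have h := mem_sphere_quaternion_iff.mp q.2
  rw [SO.mem_iff]
  constructor
  · ext i j
    fin_cases i <;> fin_cases j <;>
      simp [quaternionMatrix, Matrix.mul_apply, Fin.sum_univ_three] <;> grind
  · simp [quaternionMatrix, Matrix.det_fin_three]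
    grind

theorem continuous_quaternionMatrix : Continuous quaternionMatrix := by
  have h1 := Quaternion.continuous_re
  have h2 := Quaternion.continuous_imI
  have h3 := Quaternion.continuous_imJ
  have h4 := Quaternion.continuous_imK
  refine continuous_matrix fun i j => ?_
  fin_cases i <;> fin_cases j <;> simp [quaternionMatrix] <;> fun_prop

/-- The homomorphism from the unit quaternions to `SO(3)` that sends `q` to the rotation
`x ↦ q x q⁻¹` of the purely imaginary quaternions. -/
noncomputable def quaternionToSO : sphere (0 : ℍ[ℝ]) 1 →* SO 3 where
  toFun q := ⟨quaternionMatrix q, quaternionMatrix_mem q⟩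
  map_one' := Subtype.ext quaternionMatrix_one
  map_mul' p q := Subtype.ext (quaternionMatrix_mul p q)

theorem continuous_quaternionToSO : Continuous quaternionToSO :=
  (continuous_quaternionMatrix.comp continuous_subtype_val).subtype_mk _

theorem quaternionToSO_eq_one_iff {q : sphere (0 : ℍ[ℝ]) 1} :
    quaternionToSO q = 1 ↔ q = 1 ∨ q = -1 := by
  constructor
  · intro h
    have h1 := mem_sphere_quaternion_iff.mp q.2
    have h2 (i j : Fin 3) : quaternionMatrix q i j = (1 : Matrix (Fin 3) (Fin 3) ℝ) i j :=
      congrArg (fun A : SO 3 ↦ A.1 i j) h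
    have h00 := h2 0 0
    have h11 := h2 1 1
    have h22 := h2 2 2
    simp [quaternionMatrix] at h00 h11 h22
    have hI : q.1.imI = 0 := by nlinarith
    have hJ : q.1.imJ = 0 := by nlinarith
    have hK : q.1.imK = 0 := by nlinarith
    have hre : q.1.re = 1 ∨ q.1.re = -1 := by
      rw [← sq_eq_one_iff]; nlinarith
    refine hre.imp (fun h ↦ Subtype.ext ?_) (fun h ↦ Subtype.ext ?_) <;>
      ext <;> simp [h, hI, hJ, hK]
  · rintro (rfl | rfl)
    · exact map_one _
    · refine Subtype.ext ?_
      ext i j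
      fin_cases i <;> fin_cases j <;> simp [quaternionToSO, quaternionMatrix]

/-- The cofactors of a rotation matrix are its entries. -/
theorem SO.adjugate_eq (R : SO 3) : R.1.adjugate = R.1ᵀ := by
  obtain ⟨h1, h2⟩ := SO.mem_iff.mp R.2
  have h := Matrix.adjugate_mul R.1
  rw [h2, one_smul] at h
  calc R.1.adjugate = R.1.adjugate * (R.1 * R.1ᵀ) := by rw [h1, mul_one]
    _ = R.1ᵀ := by rw [← mul_assoc, h, one_mul]

/-- A rotation `A` that is not a half-turn (that is, `1 + tr A > 0`) comes from the unit quaternion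
proportional to `(1 + tr A, A 2 1 - A 1 2, A 0 2 - A 2 0, A 1 0 - A 0 1)`. -/
theorem exists_quaternionToSO_eq_of_trace_pos (R : SO 3)
    (hR : 0 < 1 + R.1 0 0 + R.1 1 1 + R.1 2 2) : ∃ q, quaternionToSO q = R := by
  have hrow (i j : Fin 3) := congrFun (congrFun (SO.mem_iff.mp R.2).1 i) j
  have hcol (i j : Fin 3) :=
    congrFun (congrFun (show R.1ᵀ * R.1 = 1 from mul_eq_one_comm.mp (SO.mem_iff.mp R.2).1) i) j
  have hadj (i j : Fin 3) := congrFun (congrFun (SO.adjugate_eq R) i) j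
  simp only [Matrix.adjugate_fin_three, Matrix.mul_apply, Fin.sum_univ_three,
    Matrix.transpose_apply, Matrix.one_apply, Matrix.of_apply] at hrow hcol hadj
  set A := R.1
  -- The products of the four coordinates `1 + tr A`, `A 2 1 - A 1 2`, `A 0 2 - A 2 0`,
  -- `A 1 0 - A 0 1` are `1 + tr A` times linear functions of the entries of `A`.
  have hxx : (A 2 1 - A 1 2) ^ 2 =
      (1 + A 0 0 + A 1 1 + A 2 2) * (1 + A 0 0 - A 1 1 - A 2 2) := by
    linear_combination (norm := (simp only [Matrix.cons_val, if_true]; ring1))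
      2 * hadj 0 0 + hrow 1 1 + hrow 2 2 - hcol 0 0
  have hyy : (A 0 2 - A 2 0) ^ 2 =
      (1 + A 0 0 + A 1 1 + A 2 2) * (1 - A 0 0 + A 1 1 - A 2 2) := by
    linear_combination (norm := (simp only [Matrix.cons_val, if_true]; ring1))
      2 * hadj 1 1 + hrow 0 0 + hrow 2 2 - hcol 1 1
  have hzz : (A 1 0 - A 0 1) ^ 2 =
      (1 + A 0 0 + A 1 1 + A 2 2) * (1 - A 0 0 - A 1 1 + A 2 2) := by
    linear_combination (norm := (simp only [Matrix.cons_val, if_true]; ring1))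
      2 * hadj 2 2 + hrow 0 0 + hrow 1 1 - hcol 2 2
  have hxy : (A 2 1 - A 1 2) * (A 0 2 - A 2 0) =
      (1 + A 0 0 + A 1 1 + A 2 2) * (A 0 1 + A 1 0) := by
    linear_combination (norm := (simp only [Matrix.cons_val, Fin.reduceEq, if_false]; ring1))
      hadj 0 1 + hadj 1 0 - hcol 0 1 - hrow 0 1
  have hxz : (A 2 1 - A 1 2) * (A 1 0 - A 0 1) =
      (1 + A 0 0 + A 1 1 + A 2 2) * (A 0 2 + A 2 0) := by
    linear_combination (norm := (simp only [Matrix.cons_val, Fin.reduceEq, if_false]; ring1))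
      hadj 0 2 + hadj 2 0 - hcol 0 2 - hrow 0 2
  have hyz : (A 0 2 - A 2 0) * (A 1 0 - A 0 1) =
      (1 + A 0 0 + A 1 1 + A 2 2) * (A 1 2 + A 2 1) := by
    linear_combination (norm := (simp only [Matrix.cons_val, Fin.reduceEq, if_false]; ring1))
      hadj 1 2 + hadj 2 1 - hcol 1 2 - hrow 1 2
  have hs : (Real.sqrt (1 + A 0 0 + A 1 1 + A 2 2))⁻¹ ^ 2 * (1 + A 0 0 + A 1 1 + A 2 2) = 1 := by
    rw [inv_pow, Real.sq_sqrt hR.le, inv_mul_cancel₀ hR.ne']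
  -- The vector of the four coordinates has length `2 √(1 + tr A)`.
  generalize (Real.sqrt (1 + A 0 0 + A 1 1 + A 2 2))⁻¹ = s at hs
  let q : ℍ[ℝ] := ⟨s * (1 + A 0 0 + A 1 1 + A 2 2) / 2, s * (A 2 1 - A 1 2) / 2,
    s * (A 0 2 - A 2 0) / 2, s * (A 1 0 - A 0 1) / 2⟩
  have hq : q ∈ sphere (0 : ℍ[ℝ]) 1 := by
    rw [mem_sphere_quaternion_iff]
    linear_combination (s ^ 2 / 4) * (hxx + hyy + hzz) + hs
  refine ⟨⟨q, hq⟩, Subtype.ext ?_⟩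
  ext i j
  fin_cases i <;> fin_cases j
  · change q.re ^ 2 + q.imI ^ 2 - q.imJ ^ 2 - q.imK ^ 2 = A 0 0
    linear_combination (s ^ 2 / 4) * (hxx - hyy - hzz) + A 0 0 * hs
  · change 2 * (q.imI * q.imJ - q.re * q.imK) = A 0 1
    linear_combination (s ^ 2 / 2) * hxy + A 0 1 * hs
  · change 2 * (q.imI * q.imK + q.re * q.imJ) = A 0 2
    linear_combination (s ^ 2 / 2) * hxz + A 0 2 * hs
  · change 2 * (q.imI * q.imJ + q.re * q.imK) = A 1 0
    linear_combination (s ^ 2 / 2) * hxy + A 1 0 * hs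
  · change q.re ^ 2 - q.imI ^ 2 + q.imJ ^ 2 - q.imK ^ 2 = A 1 1
    linear_combination (s ^ 2 / 4) * (hyy - hxx - hzz) + A 1 1 * hs
  · change 2 * (q.imJ * q.imK - q.re * q.imI) = A 1 2
    linear_combination (s ^ 2 / 2) * hyz + A 1 2 * hs
  · change 2 * (q.imI * q.imK - q.re * q.imJ) = A 2 0
    linear_combination (s ^ 2 / 2) * hxz + A 2 0 * hs
  · change 2 * (q.imJ * q.imK + q.re * q.imI) = A 2 1
    linear_combination (s ^ 2 / 2) * hyz + A 2 1 * hs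
  · change q.re ^ 2 - q.imI ^ 2 - q.imJ ^ 2 + q.imK ^ 2 = A 2 2
    linear_combination (s ^ 2 / 4) * (hzz - hxx - hyy) + A 2 2 * hs

theorem quaternionToSO_surjective : Function.Surjective quaternionToSO := by
  intro R
  have key (q : ℍ[ℝ]) (hq : q.re ^ 2 + q.imI ^ 2 + q.imJ ^ 2 + q.imK ^ 2 = 1)
      (h : 0 < 1 + (R.1 * quaternionMatrix q) 0 0 + (R.1 * quaternionMatrix q) 1 1 +
        (R.1 * quaternionMatrix q) 2 2) : ∃ p, quaternionToSO p = R := by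
    let q' : sphere (0 : ℍ[ℝ]) 1 := ⟨q, mem_sphere_quaternion_iff.mpr hq⟩
    obtain ⟨p, hp⟩ := exists_quaternionToSO_eq_of_trace_pos (R * quaternionToSO q') h
    exact ⟨p * q'⁻¹, by rw [map_mul, hp, map_inv, mul_inv_cancel_right]⟩
  -- The numbers `1 + tr (R * quaternionMatrix q)` for `q = 1, i, j, k` have the sum `4`, so that
  -- one of them is positive.
  by_contra hne
  have h1 := mt (key ⟨1, 0, 0, 0⟩ (by norm_num)) hne
  have hi := mt (key ⟨0, 1, 0, 0⟩ (by norm_num)) hne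
  have hj := mt (key ⟨0, 0, 1, 0⟩ (by norm_num)) hne
  have hk := mt (key ⟨0, 0, 0, 1⟩ (by norm_num)) hne
  simp [quaternionMatrix, Matrix.mul_apply, Fin.sum_univ_three] at h1 hi hj hk
  linarith

theorem isQuotientCoveringMap_quaternionToSO :
    IsQuotientCoveringMap quaternionToSO quaternionToSO.ker := by
  refine Topology.IsQuotientMap.isQuotientCoveringMap_of_isDiscrete_ker_monoidHom
    (continuous_quaternionToSO.isClosedMap.isQuotientMap continuous_quaternionToSO
      quaternionToSO_surjective) ?_
  refine Set.Finite.isDiscrete ((Set.toFinite {1, -1}).subset fun q hq ↦ ?_)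
  exact quaternionToSO_eq_one_iff.mp hq

/-- A loop in `SO(3)` that lifts to a path of unit quaternions between antipodal points generates
the fundamental group. The unit quaternions being simply connected, `π₁(SO(3))` embeds in the
(opposite of the) covering group `{1, -1}`, and the class of such a loop is sent to `-1`. -/
theorem zpowers_eq_top_of_lift {q : sphere (0 : ℍ[ℝ]) 1} (Γ : Path q (-q)) {x : SO 3}
    (hx : quaternionToSO q = x) (γ : Path x x) (hγ : ∀ t, quaternionToSO (Γ t) = γ t) :
    Subgroup.zpowers (FundamentalGroup.fromPath (Path.Homotopic.Quotient.mk γ)) = ⊤ := by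
  have : SimplyConnectedSpace (sphere (0 : ℍ[ℝ]) 1) :=
    simplyConnectedSpace_sphere (by rw [Quaternion.finrank_eq_four]; norm_num)
  have hp := isQuotientCoveringMap_quaternionToSO
  let e : quaternionToSO ⁻¹' {x} := ⟨q, hx⟩
  let Φ := hp.fundamentalGroupToMulOpposite e
  have hΦ : Function.Injective Φ := hp.fundamentalGroupToMulOpposite_injective e
  have hker (g : quaternionToSO.kerᵐᵒᵖ) : g = 1 ∨ g.unop.1 = -1 :=
    (quaternionToSO_eq_one_iff.mp g.unop.2).imp_left fun h ↦
      MulOpposite.unop_injective (Subtype.ext h)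
  set c : FundamentalGroup (SO 3) x := FundamentalGroup.fromPath (Path.Homotopic.Quotient.mk γ)
  have hc : (Φ c).unop.1 = -1 := by
    have hnq : quaternionToSO (-q) = x := by rw [← Γ.target, hγ, γ.target]
    have h1 : hp.isCoveringMap.monodromy c e = ⟨-q, hnq⟩ := by
      refine hp.isCoveringMap.monodromy_eq_of_map_eq (Path.Homotopic.Quotient.mk Γ) ?_
      refine congrArg Path.Homotopic.Quotient.mk ?_
      ext1
      exact funext hγ
    have h2 := hp.unop_fundamentalGroupToMulOpposite_smul (e := e) (γ := c)
    rw [h1] at h2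
    have h3 : (Φ c).unop.1.1 * q.1 = -1 * q.1 := (congrArg Subtype.val h2).trans (by simp)
    exact Subtype.ext (mul_right_cancel₀ (ne_zero_of_mem_unit_sphere q) h3)
  rw [eq_top_iff]
  intro g _
  rcases hker (Φ g) with h | h
  · rw [hΦ (h.trans (map_one Φ).symm)]
    exact one_mem _
  · rw [hΦ (MulOpposite.unop_injective (Subtype.ext (h.trans hc.symm)))]
    exact Subgroup.mem_zpowers c

/-! ### The covering of `SO(2)` by the line -/

theorem planeRotation_eq_iff {θ η : ℝ} : planeRotation θ = planeRotation η ↔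
    (θ : Real.Angle) = η := by
  constructor
  · intro h
    have h2 (i j : Fin 2) : (planeRotation θ).1 i j = (planeRotation η).1 i j := by rw [h]
    exact Real.Angle.cos_sin_inj (by simpa [planeRotation] using h2 0 0)
      (by simpa [planeRotation] using h2 1 0)
  · intro h
    have hc := congrArg Real.Angle.cos h
    have hs := congrArg Real.Angle.sin h
    simp only [Real.Angle.cos_coe, Real.Angle.sin_coe] at hc hs
    simp only [planeRotation, hc, hs]

theorem planeRotation_two_pi_mul_eq_iff {s t : ℝ} :
    planeRotation (2 * Real.pi * s) = planeRotation (2 * Real.pi * t) ↔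
      t + -s ∈ AddSubgroup.zmultiples (1 : ℝ) := by
  rw [planeRotation_eq_iff, eq_comm, Real.Angle.angle_eq_iff_two_pi_dvd_sub,
    AddSubgroup.mem_zmultiples_iff]
  refine exists_congr fun k ↦ ?_
  have := Real.pi_ne_zero
  simp
  grind

theorem exists_planeRotation_eq (A : SO 2) :
    ∃ t ∈ Set.Icc (0 : ℝ) 1, planeRotation (2 * Real.pi * t) = A := by
  obtain ⟨h1, h2, h3⟩ := Matrix.mem_specialOrthogonalGroup_fin_two_iff.mp A.2
  let z : ℂ := ⟨A.1 0 0, A.1 1 0⟩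
  have hz : ‖z‖ = 1 := by
    rw [Complex.norm_def, Complex.normSq_apply, Real.sqrt_eq_one]
    simp [z]; grind
  have hA : planeRotation z.arg = A := by
    have hz0 : z ≠ 0 := norm_ne_zero_iff.mp (by simp [hz])
    refine Subtype.ext ?_
    ext i j
    fin_cases i <;> fin_cases j <;>
      simp [planeRotation, Complex.cos_arg hz0, Complex.sin_arg, hz, z] <;> grind
  refine ⟨Int.fract (z.arg / (2 * Real.pi)), ⟨Int.fract_nonneg _, (Int.fract_lt_one _).le⟩, ?_⟩
  rw [← hA]
  conv_rhs => rw [← mul_div_cancel₀ z.arg Real.two_pi_pos.ne']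
  rw [planeRotation_two_pi_mul_eq_iff]
  refine ⟨⌊z.arg / (2 * Real.pi)⌋, ?_⟩
  simp [← sub_eq_add_neg, Int.self_sub_fract]

theorem continuous_planeRotation : Continuous planeRotation := by
  refine Continuous.subtype_mk (continuous_matrix fun i j => ?_) _
  fin_cases i <;> fin_cases j <;> simp <;> fun_prop

/-- The map `t ↦ (rotation by 2πt)` presents `SO(2)` as `ℝ / ℤ`. It is a quotient map because it is
already onto on the compact interval `[0, 1]`. -/
theorem isAddQuotientCoveringMap_planeRotation :
    IsAddQuotientCoveringMap (fun t : ℝ ↦ planeRotation (2 * Real.pi * t))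
      (AddSubgroup.zmultiples (1 : ℝ)) := by
  have hc : Continuous fun t : ℝ ↦ planeRotation (2 * Real.pi * t) :=
    continuous_planeRotation.comp (by fun_prop)
  have hq : Topology.IsQuotientMap fun t : ℝ ↦ planeRotation (2 * Real.pi * t) := by
    have hc' : Continuous fun t : Set.Icc (0 : ℝ) 1 ↦ planeRotation (2 * Real.pi * t) :=
      hc.comp continuous_subtype_val
    refine Topology.IsQuotientMap.of_comp continuous_subtype_val hc
      (hc'.isClosedMap.isQuotientMap hc' fun A ↦ ?_)
    obtain ⟨t, ht, rfl⟩ := exists_planeRotation_eq A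
    exact ⟨⟨t, ht⟩, rfl⟩
  have hd : DiscreteTopology (AddSubgroup.zmultiples (1 : ℝ)) := inferInstance
  exact hq.isAddQuotientCoveringMap_of_addSubgroup _ ⟨hd⟩
    planeRotation_two_pi_mul_eq_iff

/-- The fundamental group of `SO(2)` is infinite cyclic, generated by the standard loop: the
covering by `ℝ` identifies it with `ℤ`, the deck group, and the standard loop with `1`. -/
theorem bijective_zpowers_planeRotationClass :
    Function.Bijective (zpowersHom (FundamentalGroup (SO 2) 1) planeRotationClass) := by
  have hp := isAddQuotientCoveringMap_planeRotation
  let e : (fun t : ℝ ↦ planeRotation (2 * Real.pi * t)) ⁻¹' {1} :=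
    ⟨0, planeRotationLoop.source⟩
  let Φ := hp.fundamentalGroupEquiv e
  let u : AddSubgroup.zmultiples (1 : ℝ) := ⟨1, AddSubgroup.mem_zmultiples 1⟩
  -- The lift of the standard loop that starts at `0` is the inclusion of `[0, 1]`, with end `1`.
  have hΦ : Φ planeRotationClass = MulOpposite.op (Multiplicative.ofAdd u) := by
    refine hp.fundamentalGroupToMulOpposite_apply_eq_Iff.mpr ?_
    let e' : (fun t : ℝ ↦ planeRotation (2 * Real.pi * t)) ⁻¹' {1} :=
      ⟨1, planeRotationLoop.target⟩
    let Γ : Path (0 : ℝ) 1 := ⟨⟨fun t ↦ t, by fun_prop⟩, rfl, rfl⟩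
    have h1 : hp.isCoveringMap.monodromy planeRotationClass e = e' := by
      refine hp.isCoveringMap.monodromy_eq_of_map_eq (Path.Homotopic.Quotient.mk Γ) ?_
      exact congrArg Path.Homotopic.Quotient.mk (by ext1; rfl)
    rw [h1]
    exact add_zero (1 : ℝ)
  have hz (n : Multiplicative ℤ) : Φ (zpowersHom _ planeRotationClass n) =
      MulOpposite.op (Multiplicative.ofAdd (n.toAdd • u)) := by
    rw [zpowersHom_apply, map_zpow, hΦ]
    rfl
  have hu (k : ℤ) : ((k • u : AddSubgroup.zmultiples (1 : ℝ)) : ℝ) = k := by simp [u]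
  constructor
  · intro m n h
    have h1 : m.toAdd • u = n.toAdd • u := by
      have := congrArg Φ h
      rw [hz, hz] at this
      exact Multiplicative.ofAdd.injective (MulOpposite.op_injective this)
    have h2 := congrArg Subtype.val h1
    rw [hu, hu] at h2
    exact_mod_cast h2
  · intro c
    obtain ⟨k, hk⟩ := AddSubgroup.mem_zmultiples_iff.mp (Φ c).unop.toAdd.2
    refine ⟨Multiplicative.ofAdd k, Φ.injective ?_⟩
    rw [hz]
    refine MulOpposite.unop_injective (Multiplicative.toAdd.injective (Subtype.ext ?_))
    simpa [u] using hk

/-! ### Rotations about the `z`-axis -/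

/-- The unit quaternion `cos θ + sin θ k`, which acts as the rotation about the `z`-axis by the
angle `2θ`. -/
noncomputable def zAxisQuaternion (θ : ℝ) : sphere (0 : ℍ[ℝ]) 1 :=
  ⟨⟨Real.cos θ, 0, 0, Real.sin θ⟩, mem_sphere_quaternion_iff.mpr (by simp)⟩

theorem continuous_zAxisQuaternion : Continuous zAxisQuaternion := by
  refine Continuous.subtype_mk ?_ _
  let k : ℍ[ℝ] := ⟨0, 0, 0, 1⟩
  have h (θ : ℝ) : (⟨Real.cos θ, 0, 0, Real.sin θ⟩ : ℍ[ℝ]) =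
      Real.cos θ • (1 : ℍ[ℝ]) + Real.sin θ • k := by
    ext <;> simp <;> simp [k]
  simp_rw [h]
  fun_prop

theorem zAxisQuaternion_add_pi (θ : ℝ) : zAxisQuaternion (θ + Real.pi) = -zAxisQuaternion θ := by
  refine Subtype.ext (Quaternion.ext _ _ (Real.cos_add_pi θ) ?_ ?_ (Real.sin_add_pi θ))
  · exact neg_zero.symm
  · exact neg_zero.symm

theorem quaternionToSO_zAxisQuaternion (θ : ℝ) :
    quaternionToSO (zAxisQuaternion θ) = inclSO (planeRotation (2 * θ)) := by
  refine Subtype.ext ?_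
  ext i j
  have := Real.sin_sq_add_cos_sq θ
  fin_cases i <;> fin_cases j <;>
    simp [quaternionToSO, quaternionMatrix, zAxisQuaternion, inclSO, blockMatrix, planeRotation,
      Real.cos_two_mul, Real.sin_two_mul] <;> linarith

/-- The rotation given by the point `(0, 0, r)`, for `r` of either sign, is the rotation about the
`z`-axis by the signed angle `r`. -/
theorem vectorRotation_zAxisPoint (s : ℝ) :
    vectorRotation (zAxisPoint s) = (inclSO (planeRotation (Real.pi * Real.cos s))).1 := by
  have hn : ‖(zAxisPoint s).1‖ = |Real.pi * Real.cos s| := by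
    simp [zAxisPoint, EuclideanSpace.norm_eq, Fin.sum_univ_three, Real.sqrt_sq_eq_abs]
  have h0 : (zAxisPoint s).1 0 = 0 := rfl
  have h1 : (zAxisPoint s).1 1 = 0 := rfl
  have h2 : (zAxisPoint s).1 2 = Real.pi * Real.cos s := rfl
  rw [vectorRotation, axisRotation, hn, Real.cos_abs]
  generalize Real.pi * Real.cos s = r at *
  have hsin : Real.sin |r| * (|r|⁻¹ * r) = Real.sin r := by
    rcases lt_trichotomy r 0 with h | rfl | h
    · rw [abs_of_neg h, Real.sin_neg, inv_neg, neg_mul, neg_mul, mul_neg, neg_neg,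
        inv_mul_cancel₀ h.ne, mul_one]
    · simp
    · rw [abs_of_pos h, inv_mul_cancel₀ h.ne', mul_one]
  have hcos : (1 - Real.cos r) * (|r|⁻¹ * r * (|r|⁻¹ * r)) = 1 - Real.cos r := by
    rcases eq_or_ne r 0 with rfl | h
    · simp
    · have : |r|⁻¹ * r * (|r|⁻¹ * r) = 1 := by
        have := abs_pos.mpr h
        field_simp
        rw [sq_abs]
      rw [this, mul_one]
  ext i j
  fin_cases i <;> fin_cases j <;>
    simp [crossMatrix, inclSO, blockMatrix, planeRotation, Matrix.vecMulVec_apply, h0, h1, h2,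
      hsin]
  linarith

theorem propositionA4 :
    (∃ e : FundamentalGroup (SO 2) 1 ≃* Multiplicative ℤ,
      e planeRotationClass = Multiplicative.ofAdd 1 ∧
      Subgroup.zpowers
          (FundamentalGroup.mapOfEq inclSO inclSO_one (e.symm (Multiplicative.ofAdd 1))) =
        (⊤ : Subgroup (FundamentalGroup (SO 3) 1))) ∧
    Subgroup.zpowers (FundamentalGroup.map ballModelToSO ballModelPole zAxisClass) =
      (⊤ : Subgroup (FundamentalGroup (SO 3) (ballModelToSO ballModelPole))) := by
  have hgen : zpowersHom _ planeRotationClass (Multiplicative.ofAdd 1) = planeRotationClass := by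
    rw [zpowersHom_apply, toAdd_ofAdd, zpow_one]
  refine ⟨⟨(MulEquiv.ofBijective _ bijective_zpowers_planeRotationClass).symm, ?_, ?_⟩, ?_⟩
  · rw [MulEquiv.symm_apply_eq]
    exact hgen.symm
  · rw [MulEquiv.symm_symm, MulEquiv.ofBijective_apply, hgen, FundamentalGroup.mapOfEq_apply]
    have h0 : zAxisQuaternion (Real.pi * (0 : I)) = 1 := by
      refine Subtype.ext ?_
      ext <;> simp [zAxisQuaternion]
    -- The lift `t ↦ cos πt + sin πt k` runs from `1` to `-1`.
    let Γ : Path (1 : sphere (0 : ℍ[ℝ]) 1) (-1) :=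
      ⟨⟨fun t ↦ zAxisQuaternion (Real.pi * t), continuous_zAxisQuaternion.comp (by fun_prop)⟩,
        h0, by simp [← h0, ← zAxisQuaternion_add_pi]⟩
    refine zpowers_eq_top_of_lift Γ (map_one _)
      ((planeRotationLoop.map inclSO.continuous).cast inclSO_one.symm inclSO_one.symm) fun t ↦ ?_
    refine (quaternionToSO_zAxisQuaternion _).trans (congrArg inclSO ?_)
    rw [← mul_assoc]
    rfl
  · -- Half the angle of the rotation `φ (γ t)`; it goes from `π / 2` to `-π / 2`, so that the lift
    -- of the loop runs from `k` to `-k`.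
    let θ : I → ℝ := fun t ↦ Real.pi * Real.cos (Real.pi * t) / 2
    let Γ : Path (zAxisQuaternion (Real.pi / 2)) (-zAxisQuaternion (Real.pi / 2)) :=
      ⟨⟨fun t ↦ zAxisQuaternion (θ t), continuous_zAxisQuaternion.comp (by fun_prop)⟩,
        by simp [θ], by
          rw [← neg_eq_iff_eq_neg, ← zAxisQuaternion_add_pi]
          simp [θ]; ring_nf⟩
    have hΓ (t : I) : quaternionToSO (Γ t) = ballModelToSO (zAxisLoop t) := by
      refine (quaternionToSO_zAxisQuaternion _).trans (Subtype.ext ?_)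
      rw [mul_div_cancel₀ _ two_ne_zero]
      exact (vectorRotation_zAxisPoint _).symm
    refine zpowers_eq_top_of_lift Γ ?_ (zAxisLoop.map ballModelToSO.continuous) hΓ
    simpa using hΓ 0
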